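/- We work in ZFC. An infinite cardinal $\delta$ is \emph{subtle} if for every sequence $\langle E_\gamma\mid\gamma<\delta\rangle$ with $E_\gamma\subseteq\gamma$ for all $\gamma<\delta$, and every closed unbounded subset $D$ of $\delta$, there exist $\beta<\gamma$ in $D$ with $E_\beta=E_\gamma\cap\beta$. A cardinal $\delta$ is a \emph{limit of subtle cardinals} if $\delta\neq 0$ and for every cardinal $\mu<\delta$ there is a subtle cardinal $\nu$ with $\mu<\nu<\delta$. Structures are structures, with non-empty domain, for countable first-order languages; structures are of the same type if they are structures for the same language; and the cardinality of a structure is the cardinality of its domain. Given a non-empty set $\mathcal{C}$ of structures of the same type and an infinite cardinal $\kappa$, let $\mathrm{WSR}_{\mathcal{C}}(\kappa)$ denote the conjunction of the following two statements: (i) for every structure $B$ in $\mathcal{C}$ of cardinality $\kappa$, there exist a structure $A$ in $\mathcal{C}$ of cardinality less than $\kappa$ and an elementary embedding of $A$ into $B$; (ii) $\mathcal{C}$ contains a structure of cardinality less than $\kappa$. \textbf{Theorem.} The following statements are equivalent for every uncountable cardinal $\delta$: (1) $\delta$ is either subtle or a limit of subtle cardinals. (2) For every set $\mathcal{C}$ of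 structures of the same type with $\mathcal{C}\in V_{\delta+1}\setminus V_\delta$, there exists an infinite cardinal $\kappa<\delta$ such that $\mathrm{WSR}_{\mathcal{C}}(\kappa)$ holds. -/

import Mathlib

universe u

namespace SetTheoreticReflection

open FirstOrder FirstOrder.Language Cardinal

/-- An infinite cardinal `δ` is *subtle* if for every list `⟨E γ | γ < δ⟩` with `E γ ⊆ γ` for all
`γ < δ`, and every closed unbounded subset `C` of `δ`, there are `β < γ` in `C` with
`E β = E γ ∩ β`. The cardinal `δ` is identified with the set of ordinals below `δ.ord`. -/
def IsSubtle (δ : Cardinal.{u}) : Prop :=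
  ℵ₀ ≤ δ ∧
    ∀ E : Set.Iio δ.ord → Set (Set.Iio δ.ord), (∀ γ, E γ ⊆ Set.Iio γ) →
      ∀ C : Set (Set.Iio δ.ord), IsClub C →
        ∃ β ∈ C, ∃ γ ∈ C, β < γ ∧ E β = E γ ∩ Set.Iio β

/-- `δ` is a limit of subtle cardinals: there are subtle cardinals cofinally below `δ`
(for `δ ≠ 0`). -/
def IsLimitOfSubtle (δ : Cardinal.{u}) : Prop :=
  δ ≠ 0 ∧ ∀ μ < δ, ∃ ν, μ < ν ∧ ν < δ ∧ IsSubtle ν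

/-- An `L`-structure whose domain is a (non-empty) set of the universe `ZFSet` of sets. -/
structure SetStructure (L : FirstOrder.Language.{0, 0}) where
  /-- The domain. -/
  dom : ZFSet.{u}
  /-- The domain is non-empty. -/
  dom_nonempty : dom.Nonempty
  /-- The interpretations of the function and relation symbols on the domain. -/
  str : L.Structure dom

attribute [instance] SetStructure.str

/-- The finite tuple `(v 0, …, v (n-1))` of sets, as a set, by iterated Kuratowski pairs. -/
noncomputable def tuple : {n : ℕ} → (Fin n → ZFSet.{u}) → ZFSet.{u}
  | 0, _ => ∅
  | _ + 1, v => ZFSet.pair (v 0) (tuple (Fin.tail v))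

namespace SetStructure

variable {L : FirstOrder.Language.{0, 0}}

/-- The interpretation of a symbol in a structure, as a set: a function symbol is interpreted by
the graph of the corresponding function, a relation symbol by the set of tuples satisfying it. -/
noncomputable def interp (A : SetStructure.{u} L) : L.Symbols → ZFSet.{u}
  | .inl ⟨n, f⟩ => ZFSet.range fun v : Fin n → A.dom =>
      ZFSet.pair (tuple fun i => (v i : ZFSet.{u})) (Structure.funMap f v : A.dom)
  | .inr ⟨n, R⟩ => ZFSet.range fun v : {v : Fin n → A.dom // Structure.RelMap R v} =>
      tuple fun i => (v.1 i : ZFSet.{u})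

/-- The structure `A` as a set: the ordered pair consisting of its domain and of the function
sending (the set that serves as) each symbol of the language to its interpretation. The map `sym`
says which set serves as which symbol. -/
noncomputable def code (sym : L.Symbols ↪ ZFSet.{u}) (A : SetStructure.{u} L) : ZFSet.{u} :=
  ZFSet.pair A.dom (ZFSet.range fun s : L.Symbols => ZFSet.pair (sym s) (A.interp s))

end SetStructure

variable {L : FirstOrder.Language.{0, 0}}

/-- `C` is a set of structures of the same type, namely of `L`-structures, where the symbols of the
language `L` are the sets given by `sym`. -/
def IsSetOfStructures (sym : L.Symbols ↪ ZFSet.{u}) (C : ZFSet.{u}) : Prop :=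
  ∀ x ∈ C, ∃ A : SetStructure.{u} L, A.code sym = x

/-- `SR⁻_C(κ)`: for every structure `B` in `C` of cardinality `κ` there are a structure `A` in `C` of
cardinality less than `κ` and an elementary embedding of `A` into `B`. -/
def SRMinus (sym : L.Symbols ↪ ZFSet.{u}) (C : ZFSet.{u}) (κ : Cardinal.{u}) : Prop :=
  ∀ B : SetStructure.{u} L, B.code sym ∈ C → B.dom.card = κ →
    ∃ A : SetStructure.{u} L, A.code sym ∈ C ∧ A.dom.card < κ ∧ Nonempty (A.dom ↪ₑ[L] B.dom)

/-- `SR⁻⁻_C(κ)`: the set `C` contains a structure of cardinality less than `κ`. -/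
def SRMinusMinus (sym : L.Symbols ↪ ZFSet.{u}) (C : ZFSet.{u}) (κ : Cardinal.{u}) : Prop :=
  ∃ A : SetStructure.{u} L, A.code sym ∈ C ∧ A.dom.card < κ

/-- `WSR_C(κ)`, weak structural reflection, for an infinite cardinal `κ`. -/
def WSR (sym : L.Symbols ↪ ZFSet.{u}) (C : ZFSet.{u}) (κ : Cardinal.{u}) : Prop :=
  ℵ₀ ≤ κ ∧ SRMinus sym C κ ∧ SRMinusMinus sym C κ

theorem tuple_injective : ∀ {n : ℕ}, Function.Injective (tuple.{u} (n := n))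
  | 0, _, _, _ => Subsingleton.elim _ _
  | n + 1, v, w, h => by
      simp only [tuple, ZFSet.pair_inj] at h
      have h2 := tuple_injective h.2
      rw [← Fin.cons_self_tail v, ← Fin.cons_self_tail w, h.1, h2]

/-- A structure is determined by the set that represents it. -/
theorem SetStructure.code_injective (sym : L.Symbols ↪ ZFSet.{u}) :
    Function.Injective (SetStructure.code (L := L) sym) := by
  rintro ⟨D, hD, S⟩ ⟨D', hD', S'⟩ h
  obtain ⟨rfl, h⟩ := ZFSet.pair_inj.1 h
  have key : ∀ s, SetStructure.interp ⟨D, hD, S⟩ s = SetStructure.interp ⟨D, hD', S'⟩ s := by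
    intro s
    have hs : ZFSet.pair (sym s) (SetStructure.interp ⟨D, hD, S⟩ s) ∈
        ZFSet.range fun s : L.Symbols =>
          ZFSet.pair (sym s) (SetStructure.interp ⟨D, hD', S'⟩ s) := by
      rw [← h]; exact ZFSet.mem_range.2 ⟨s, rfl⟩
    obtain ⟨t, ht⟩ := ZFSet.mem_range.1 hs
    obtain ⟨h1, h2⟩ := ZFSet.pair_inj.1 ht
    rw [← h2, sym.injective h1]
  have inj : ∀ {n : ℕ} {v w : Fin n → D},
      (tuple fun i => (v i : ZFSet.{u})) = (tuple fun i => (w i : ZFSet.{u})) → v = w := by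
    intro n v w hvw
    funext i
    exact Subtype.ext (congrFun (tuple_injective hvw) i)
  have hS : S = S' := by
    refine Structure.ext ?_ ?_
    · funext n f v
      have hk := key (.inl ⟨n, f⟩)
      simp only [SetStructure.interp] at hk
      have hm := ZFSet.mem_range_self (f := fun v : Fin n → D =>
        ZFSet.pair (tuple fun i => (v i : ZFSet.{u})) (S.funMap f v : D)) v
      rw [hk] at hm
      obtain ⟨w, hw⟩ := ZFSet.mem_range.1 hm
      obtain ⟨h1, h2⟩ := ZFSet.pair_inj.1 hw
      cases inj h1
      exact (Subtype.ext h2).symm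
    · funext n R v
      have hk := key (.inr ⟨n, R⟩)
      simp only [SetStructure.interp] at hk
      refine propext ⟨fun hv => ?_, fun hv => ?_⟩
      · have hm := ZFSet.mem_range_self (f := fun v : {v : Fin n → D // S.RelMap R v} =>
          tuple fun i => (v.1 i : ZFSet.{u})) ⟨v, hv⟩
        rw [hk] at hm
        obtain ⟨w, hw⟩ := ZFSet.mem_range.1 hm
        cases inj hw
        exact w.2
      · have hm := ZFSet.mem_range_self (f := fun v : {v : Fin n → D // S'.RelMap R v} =>
          tuple fun i => (v.1 i : ZFSet.{u})) ⟨v, hv⟩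
        rw [← hk] at hm
        obtain ⟨w, hw⟩ := ZFSet.mem_range.1 hm
        cases inj hw
        exact w.2
  subst hS
  rfl

end SetTheoreticReflection

/-!
Both directions rest on identifying structures of size `κ` with structures on the ordinal `κ`.

If `ν` is subtle and weak structural reflection fails at every `κ < ν`, although `C` has an element
of size less than `ν`, then for all large `κ < ν` there is some `B κ` in `C` of size `κ` into which
no smaller element of `C` embeds elementarily. The elementary diagrams of the `B κ` are coded as
subsets of `κ`, uniformly along a closed unbounded set of cardinals, and subtlety makes the diagram
of some `B β` the restriction of that of a larger `B γ`, so that the inclusion is elementary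
(`IsSubtle.exists_WSR`). Subtle cardinals are inaccessible (`IsSubtle.isInaccessible`), so every
element of `V_ν` has size less than `ν`; this gives the theorem at subtle cardinals and at their
limits.

Conversely, suppose that there are no subtle cardinals in `(μ, δ]`, where `ℵ₀ ≤ μ < δ`. The failures
of subtlety can be glued into a single list `F` such that `F β ≠ F γ ∩ β` for all `μ < β < γ < δ`
(`exists_disagree`; here each `F β` is a countable sequence of sets of ordinals). The structure on a
cardinal `κ` in `[μ⁺, δ)` consists of the order, the list `F` below `κ`, the sets `F κ`, and functions
on `μ⁺` that make `μ⁺` rigid. No smaller structure embeds into a larger one: an embedding `j` fixes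
`μ⁺` pointwise, so the least ordinal `α` that it moves is above `μ`, whence `F α = F (j α) ∩ α`; and if
it moves nothing, then `F β = F γ ∩ β` for the two sizes (`isEmpty_elementaryEmbedding`). All copies
of these structures in `V_δ` form the required set (`exists_not_WSR`).

The rigidity of `μ⁺` (`exists_rigid_functions`) follows Woodin's proof of Kunen's inconsistency
theorem, with a partition of the points of countable cofinality into stationary sets.
-/

namespace SetTheoreticReflection

open FirstOrder FirstOrder.Language Cardinal Ordinal Set Order

/-! ### Subtle cardinals are inaccessible -/

/-- `D` is closed and unbounded in the ordinal `o`. Closure is phrased without suprema: `x`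
belongs to `D` as soon as the intervals `(a, x]` for `a < x`, and the interval `[0, x]`, meet `D`.
Elements of `D` outside `o` are irrelevant. -/
structure IsClubIn (D : Set Ordinal.{u}) (o : Ordinal.{u}) : Prop where
  mem_of_approx : ∀ x < o, (∃ y ∈ D, y ≤ x) → (∀ a < x, ∃ y ∈ D, a < y ∧ y ≤ x) → x ∈ D
  exists_ge : ∀ a < o, ∃ b ∈ D, a ≤ b ∧ b < o

theorem IsClubIn.isClub_preimage {D : Set Ordinal.{u}} {o : Ordinal.{u}} (h : IsClubIn D o) :
    IsClub ((↑) ⁻¹' D : Set (Iio o)) := by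
  refine ⟨fun t ht ht0 _ x hx => ?_, fun a => ?_⟩
  · refine h.mem_of_approx x x.2 ?_ fun a ha => ?_
    · obtain ⟨y, hy⟩ := ht0
      exact ⟨y, ht hy, hx.1 hy⟩
    · obtain ⟨y, hy, hay⟩ := (lt_isLUB_iff hx).1
        (show (⟨a, ha.trans x.2⟩ : Iio o) < x from ha)
      exact ⟨y, ht hy, hay, hx.1 hy⟩
  · obtain ⟨b, hb, hab, hbo⟩ := h.exists_ge a a.2
    exact ⟨⟨b, hbo⟩, hb, hab⟩

theorem isClubIn_image_of_isClub {o : Ordinal.{u}} {C : Set (Iio o)} (h : IsClub C) :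
    IsClubIn ((↑) '' C) o := by
  refine ⟨?_, fun a ha => ?_⟩
  · rintro x hx ⟨-, ⟨y, hy, rfl⟩, hyx⟩ H
    refine ⟨⟨x, hx⟩, h.isLUB_mem (t := {y ∈ C | (y : Ordinal) ≤ x}) (fun z hz => hz.1)
      ⟨y, hy, hyx⟩ ⟨fun z hz => hz.2, fun z hz => ?_⟩, rfl⟩
    by_contra hlt
    obtain ⟨-, ⟨w, hw, rfl⟩, h1, h2⟩ := H z (not_le.1 hlt)
    exact (hz ⟨hw, h2⟩).not_gt h1
  · obtain ⟨b, hb, hab⟩ := h.isCofinal ⟨a, ha⟩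
    exact ⟨b, ⟨b, hb, rfl⟩, hab, b.2⟩

theorem isClubIn_Ici {l o : Ordinal.{u}} (h : l < o) : IsClubIn (Ici l) o where
  mem_of_approx := by
    rintro x - ⟨y, hy, hyx⟩ -
    exact le_trans hy hyx
  exists_ge a ha := ⟨max l a, le_max_left l a, le_max_right l a, max_lt h ha⟩

/-- Subtlety for lists of sets of ordinals: only the traces `E γ ∩ γ` matter, and the coherence
`E β = E γ ∩ β` becomes agreement below `β`. -/
theorem IsSubtle.exists_agree {δ : Cardinal.{u}} (h : IsSubtle δ)
    (E : Ordinal.{u} → Set Ordinal.{u})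
    {D : Set Ordinal.{u}} (hD : IsClubIn D δ.ord) :
    ∃ β ∈ D, ∃ γ ∈ D, β < γ ∧ γ < δ.ord ∧ ∀ ξ < β, ξ ∈ E β ↔ ξ ∈ E γ := by
  obtain ⟨β, hβ, γ, hγ, hlt, he⟩ := h.2 (fun γ => {ξ | ξ < γ ∧ (ξ : Ordinal) ∈ E γ})
    (fun γ ξ hξ => hξ.1) _ hD.isClub_preimage
  refine ⟨β, hβ, γ, hγ, hlt, γ.2, fun ξ hξ => ?_⟩
  have := Set.ext_iff.1 he ⟨ξ, hξ.trans β.2⟩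
  have h1 : (⟨ξ, hξ.trans β.2⟩ : Iio δ.ord) < β := hξ
  simpa [h1, h1.trans hlt] using this

theorem exists_disagree_of_not_isSubtle {δ : Cardinal.{u}} (h0 : ℵ₀ ≤ δ) (h : ¬ IsSubtle δ) :
    ∃ (E : Ordinal.{u} → Set Ordinal.{u}) (D : Set Ordinal.{u}), IsClubIn D δ.ord ∧
      ∀ β ∈ D, ∀ γ ∈ D, β < γ → γ < δ.ord → ∃ ξ < β, ¬ (ξ ∈ E β ↔ ξ ∈ E γ) := by
  simp only [IsSubtle, h0, true_and, not_forall] at h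
  obtain ⟨E, hE, C, hC, hno⟩ := h
  refine ⟨fun γ => {ξ | ∃ (h1 : γ < δ.ord) (h2 : ξ < δ.ord), (⟨ξ, h2⟩ : Iio δ.ord) ∈ E ⟨γ, h1⟩},
    _, isClubIn_image_of_isClub hC, ?_⟩
  rintro - ⟨β, hβ, rfl⟩ - ⟨γ, hγ, rfl⟩ hlt -
  by_contra! hcon
  refine hno ⟨β, hβ, γ, hγ, hlt, Set.ext fun ξ => ?_⟩
  by_cases hξ : ξ < β
  · have h1 := hcon ξ hξ
    have h2 : (β : Ordinal) < δ.ord := β.2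
    have h3 : (γ : Ordinal) < δ.ord := γ.2
    have h4 : (ξ : Ordinal) < δ.ord := ξ.2
    simpa [h2, h3, h4, hξ] using h1
  · exact ⟨fun h => (hξ (hE _ h)).elim, fun h => (hξ h.2).elim⟩

/-- A list of subsets of a fixed `l < δ` indexed by a closed unbounded set beyond `l` has
repetitions, because it agrees with itself only where it repeats. -/
theorem IsSubtle.not_injOn {δ : Cardinal.{u}} (h : IsSubtle δ) {l : Ordinal.{u}}
    {D : Set Ordinal.{u}} (hD : IsClubIn D δ.ord) (hl : D ⊆ Ici l)
    (g : Ordinal.{u} → Set Ordinal.{u}) (hg : ∀ γ ∈ D, γ < δ.ord → g γ ⊆ Iio l) :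
    ¬ InjOn g (D ∩ Iio δ.ord) := by
  intro hinj
  obtain ⟨β, hβ, γ, hγ, hlt, hγδ, H⟩ := h.exists_agree g hD
  refine hlt.ne (hinj ⟨hβ, hlt.trans hγδ⟩ ⟨hγ, hγδ⟩ (Set.ext fun ξ => ?_))
  by_cases hξ : ξ < β
  · exact H ξ hξ
  · have : ¬ ξ < l := fun h' => hξ (h'.trans_le (hl hβ))
    exact ⟨fun h' => (this (hg β hβ (hlt.trans hγδ) h')).elim,
      fun h' => (this (hg γ hγ hγδ h')).elim⟩

/-- The list `E (n + 1) = {n}` shows that `ℵ₀` is not subtle. -/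
theorem IsSubtle.aleph0_lt {δ : Cardinal.{u}} (h : IsSubtle δ) : ℵ₀ < δ := by
  refine h.1.lt_of_ne ?_
  rintro rfl
  have h1 : (1 : Ordinal.{u}) < (ℵ₀ : Cardinal.{u}).ord := by simp
  obtain ⟨β, hβ, γ, hγ, hlt, hγδ, H⟩ := h.exists_agree (fun γ => {ξ | ξ + 1 = γ}) (isClubIn_Ici h1)
  obtain ⟨n, rfl⟩ := lt_omega0.1 (by simpa using hlt.trans hγδ)
  obtain ⟨m, rfl⟩ : ∃ m, n = m + 1 := by
    refine Nat.exists_eq_add_one.2 ?_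
    have : (1 : Ordinal) ≤ n := hβ
    exact_mod_cast this
  have := (H m (by exact_mod_cast Nat.lt_succ_self m)).1 (by simp)
  exact hlt.ne (by simpa using this)

/-- If `S` were cofinal of size `l < δ`, the points beyond `l` that are limits or elements of `S`
would form a closed unbounded set, and each of them is determined by the next element of `S`. -/
theorem IsSubtle.le_cof_ord {δ : Cardinal.{u}} (h : IsSubtle δ) : δ ≤ δ.ord.cof := by
  by_contra! hcof
  obtain ⟨S, hS, hSc⟩ := Order.exists_cof_eq (Iio δ.ord)
  rw [cof_Iio, ← lift_cof] at hSc
  set l := δ.ord.cof.ord with hl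
  have hlδ : l < δ.ord := ord_lt_ord.2 hcof
  have hlim : IsSuccLimit δ.ord := isSuccLimit_ord h.1
  have hcard : #S = #(Iio l) := by rw [hSc, Cardinal.mk_Iio_ordinal, hl, card_ord]
  obtain ⟨e⟩ := Cardinal.eq.1 hcard
  have hex : ∀ γ : Iio δ.ord, ∃ s ∈ S, γ < s := fun γ => by
    obtain ⟨s, hs, h1⟩ := hS ⟨succ γ.1, hlim.succ_lt γ.2⟩
    exact ⟨s, hs, (lt_succ γ.1).trans_le h1⟩
  let D : Set Ordinal.{u} := {γ | l ≤ γ ∧ ∀ a < γ, ∃ s ∈ S, a < s.1 ∧ s.1 ≤ γ}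
  have hD : IsClubIn D δ.ord := by
    refine ⟨?_, fun a ha => ?_⟩
    · rintro x - ⟨y, hy, hyx⟩ H
      refine ⟨hy.1.trans hyx, fun a ha => ?_⟩
      obtain ⟨z, hz, haz, hzx⟩ := H a ha
      obtain ⟨s, hs, h1, h2⟩ := hz.2 a haz
      exact ⟨s, hs, h1, h2.trans hzx⟩
    · obtain ⟨s, hs, h1⟩ := hS ⟨max l a, max_lt hlδ ha⟩
      have h1 : max l a ≤ s.1 := h1
      exact ⟨s, ⟨(le_max_left _ _).trans h1, fun b hb => ⟨s, hs, hb, le_rfl⟩⟩,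
        (le_max_right _ _).trans h1, s.2⟩
  -- `next γ` is the least element of `S` above `γ`
  choose next hnextS hnextlt hnextle using fun γ : Iio δ.ord =>
    show ∃ s ∈ S, γ < s ∧ ∀ t ∈ S, γ < t → s ≤ t by
      obtain ⟨s, ⟨h1, h2⟩, h3⟩ := WellFounded.has_min wellFounded_lt {s | s ∈ S ∧ γ < s} (hex γ)
      exact ⟨s, h1, h2, fun t ht ht' => not_lt.1 (h3 t ⟨ht, ht'⟩)⟩
  have hnext : ∀ β γ : Iio δ.ord, β < γ → γ.1 ∈ D → next β ≠ next γ := by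
    intro β γ hlt hγ heq
    obtain ⟨s, hs, h1, h2⟩ := hγ.2 β hlt
    have h4 := hnextlt γ
    rw [← heq] at h4
    exact ((hnextle β s hs h1).trans h2).not_gt h4
  refine h.not_injOn hD (l := l) (fun γ hγ => hγ.1)
    (fun γ => {ξ | ∃ hγ : γ < δ.ord, ξ = e ⟨next ⟨γ, hγ⟩, hnextS _⟩}) ?_ ?_
  · rintro γ - hγ ξ ⟨-, rfl⟩
    exact (e _).2
  · rintro β ⟨hβ, hβδ⟩ γ ⟨hγ, hγδ⟩ heq
    have h1 : ((e ⟨next ⟨β, hβδ⟩, hnextS _⟩ : Iio l) : Ordinal) = e ⟨next ⟨γ, hγδ⟩, hnextS _⟩ := by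
      obtain ⟨_, h⟩ := (Set.ext_iff.1 heq _).1 ⟨hβδ, rfl⟩
      exact h
    have h2 := congrArg Subtype.val (e.injective (Subtype.ext h1))
    rcases lt_trichotomy β γ with h3 | h3 | h3
    · exact (hnext ⟨β, hβδ⟩ ⟨γ, hγδ⟩ h3 hγ h2).elim
    · exact h3
    · exact (hnext ⟨γ, hγδ⟩ ⟨β, hβδ⟩ h3 hβ h2.symm).elim

/-- Otherwise `δ` indexes pairwise distinct subsets of `κ`. -/
theorem IsSubtle.two_power_lt {δ : Cardinal.{u}} (h : IsSubtle δ) {κ : Cardinal.{u}} (hκ : κ < δ) :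
    2 ^ κ < δ := by
  by_contra! hle
  have hcard : #(Iio δ.ord) ≤ #(Set (Iio κ.ord)) := by
    rw [mk_set, Cardinal.mk_Iio_ordinal, Cardinal.mk_Iio_ordinal, card_ord, card_ord]
    simpa using Cardinal.lift_le.{u + 1}.2 hle
  obtain ⟨e⟩ := hcard
  refine h.not_injOn (isClubIn_Ici (ord_lt_ord.2 hκ)) subset_rfl
    (fun γ => {ξ | ∃ hγ : γ < δ.ord, ∃ x ∈ e ⟨γ, hγ⟩, x.1 = ξ}) ?_ ?_
  · rintro γ - hγ ξ ⟨-, x, -, rfl⟩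
    exact x.2
  · rintro β ⟨-, hβδ⟩ γ ⟨-, hγδ⟩ heq
    have hβδ : β < δ.ord := hβδ
    have hγδ : γ < δ.ord := hγδ
    have : e ⟨β, hβδ⟩ = e ⟨γ, hγδ⟩ := by
      ext x
      have hx : x.1 < κ.ord := x.2
      simpa [hβδ, hγδ, hx] using Set.ext_iff.1 heq x
    exact congrArg Subtype.val (e.injective this)

theorem IsSubtle.isInaccessible {δ : Cardinal.{u}} (h : IsSubtle δ) : IsInaccessible δ :=
  ⟨h.aleph0_lt, h.le_cof_ord, fun _ hx => h.two_power_lt hx⟩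

/-! ### Reflection at subtle cardinals -/

/-- The ordinals that are closed under an operation `c` on finite lists, and under the cardinal
successor. The second condition forces them to be initial ordinals. -/
def closurePoints (c : List Ordinal.{u} → Ordinal.{u}) (γ₀ : Ordinal.{u}) : Set Ordinal.{u} :=
  {γ | γ₀ ≤ γ ∧ (∀ a < γ, (succ a.card).ord < γ) ∧
    ∀ l : List Ordinal.{u}, (∀ x ∈ l, x < γ) → c l < γ}

theorem ord_card_of_mem_closurePoints {c : List Ordinal.{u} → Ordinal.{u}} {γ₀ γ : Ordinal.{u}}
    (h : γ ∈ closurePoints c γ₀) : γ.card.ord = γ := by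
  refine (ord_card_le γ).antisymm (not_lt.1 fun hlt => ?_)
  have h1 := h.2.1 _ hlt
  rw [card_ord] at h1
  exact (lt_ord.2 (lt_succ γ.card) |>.trans h1).false

theorem isClubIn_closurePoints {δ : Cardinal.{u}} (hδ : IsInaccessible δ)
    {c : List Ordinal.{u} → Ordinal.{u}} (hc : ∀ l, (∀ x ∈ l, x < δ.ord) → c l < δ.ord)
    {γ₀ : Ordinal.{u}} (hγ₀ : γ₀ < δ.ord) : IsClubIn (closurePoints c γ₀) δ.ord := by
  refine ⟨?_, fun a ha => ?_⟩
  · rintro x hx ⟨y₀, hy₀, hy₀x⟩ H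
    refine ⟨hy₀.1.trans hy₀x, fun a ha => ?_, fun l hl => ?_⟩
    · obtain ⟨y, hy, hay, hyx⟩ := H a ha
      exact (hy.2.1 a hay).trans_le hyx
    · have key : ∀ l : List Ordinal.{u}, (∀ z ∈ l, z < x) →
          ∃ y ∈ closurePoints c γ₀, y ≤ x ∧ ∀ z ∈ l, z < y := by
        intro l
        induction l with
        | nil => exact fun _ => ⟨y₀, hy₀, hy₀x, by simp⟩
        | cons b l ih =>
          intro hl
          obtain ⟨y, hy, hyx, hly⟩ := ih fun z hz => hl z (List.mem_cons_of_mem _ hz)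
          obtain ⟨y', hy', hby', hyx'⟩ := H b (hl b List.mem_cons_self)
          rcases le_total y y' with hyy | hyy
          · refine ⟨y', hy', hyx', fun z hz => ?_⟩
            rcases List.mem_cons.1 hz with rfl | hz
            exacts [hby', (hly z hz).trans_le hyy]
          · refine ⟨y, hy, hyx, fun z hz => ?_⟩
            rcases List.mem_cons.1 hz with rfl | hz
            exacts [hby'.trans_le hyy, hly z hz]
      obtain ⟨y, hy, hyx, hly⟩ := key l hl
      exact (hy.2.2 l hly).trans_le hyx
  · have hcof : δ.ord.cof = δ := hδ.isRegular.cof_ord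
    let f : Ordinal.{u} → Ordinal.{u} := fun γ =>
      max (⨆ l : List (Iio γ), c (l.map (↑)) + 1) (succ γ.card).ord
    have hf : ∀ γ < δ.ord, f γ < δ.ord := by
      intro γ hγ
      refine max_lt (lift_iSup_add_one_lt_of_lt_cof ?_ fun l => hc _ ?_) ?_
      · have h1 : #(List (Iio γ)) < Cardinal.lift.{u + 1} δ := by
          refine (mk_list_le_max _).trans_lt (max_lt ?_ ?_)
          · simpa using hδ.aleph0_lt
          · rw [Cardinal.mk_Iio_ordinal]
            exact Cardinal.lift_lt.2 (lt_ord.1 hγ)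
        rw [← lift_cof, hcof]
        exact (Cardinal.lift_id'.{u, u + 1} _).trans_lt h1
      · intro x hx
        obtain ⟨y, -, rfl⟩ := List.mem_map.1 hx
        exact lt_trans y.2 hγ
      · exact ord_lt_ord.2 (hδ.isSuccLimit.succ_lt (lt_ord.1 hγ))
    have hlt : ∀ γ, γ < f γ := fun γ => (lt_ord.2 (lt_succ γ.card)).trans_le (le_max_right _ _)
    have hcl : ∀ γ, ∀ l : List Ordinal.{u}, (∀ x ∈ l, x < γ) → c l < f γ := by
      intro γ l hl
      refine lt_of_lt_of_le ?_ (le_max_left _ _)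
      lift l to List (Iio γ) using hl
      exact lt_iSup_add_one (fun l : List (Iio γ) => c (l.map (↑))) l
    have hmono : StrictMono fun n => f^[n] (max a γ₀) := strictMono_nat_of_lt_succ fun n => by
      rw [Function.iterate_succ_apply']
      exact hlt _
    have hle : ∀ n, f^[n] (max a γ₀) ≤ nfp f (max a γ₀) := fun n => iterate_le_nfp _ _ n
    refine ⟨nfp f (max a γ₀), ⟨(le_max_right _ _).trans (le_nfp _ _), fun b hb => ?_,
      fun l hl => ?_⟩, (le_max_left _ _).trans (le_nfp _ _),
      nfp_lt_ord (by rw [hcof]; exact hδ.aleph0_lt) hf (max_lt ha hγ₀)⟩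
    · obtain ⟨n, hn⟩ := lt_nfp_iff.1 hb
      refine lt_of_le_of_lt ?_ ((hmono (Nat.lt_succ_self (n + 1))).trans_le (hle _))
      simp only [Function.iterate_succ_apply']
      exact (ord_le_ord.2 (succ_le_succ (card_le_card hn.le))).trans (le_max_right _ _)
    · have key : ∀ l : List Ordinal.{u}, (∀ z ∈ l, z < nfp f (max a γ₀)) →
          ∃ n, ∀ z ∈ l, z < f^[n] (max a γ₀) := by
        intro l
        induction l with
        | nil => exact fun _ => ⟨0, by simp⟩
        | cons b l ih =>
          intro hl
          obtain ⟨n, hn⟩ := ih fun z hz => hl z (List.mem_cons_of_mem _ hz)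
          obtain ⟨m, hm⟩ := lt_nfp_iff.1 (hl b List.mem_cons_self)
          refine ⟨max n m, fun z hz => ?_⟩
          rcases List.mem_cons.1 hz with rfl | hz
          exacts [hm.trans_le (hmono.monotone (le_max_right _ _)),
            (hn z hz).trans_le (hmono.monotone (le_max_left _ _))]
      obtain ⟨n, hn⟩ := key l hl
      have := hcl _ l hn
      rw [← Function.iterate_succ_apply' f] at this
      exact this.trans_le (hle _)

/-- Finite lists of ordinals below an infinite cardinal can be coded by single such ordinals. -/
theorem exists_list_coding {δ : Cardinal.{u}} (hδ : ℵ₀ ≤ δ) :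
    ∃ c : List Ordinal.{u} → Ordinal.{u}, (∀ l, (∀ x ∈ l, x < δ.ord) → c l < δ.ord) ∧
      ∀ l l', (∀ x ∈ l, x < δ.ord) → (∀ x ∈ l', x < δ.ord) → c l = c l' → l = l' := by
  have : Infinite (Iio δ.ord) := by
    rw [infinite_iff, Cardinal.mk_Iio_ordinal, card_ord]
    simpa using hδ
  obtain ⟨e⟩ := Cardinal.eq.1 (mk_list_eq_mk (Iio δ.ord))
  classical
  let c : List Ordinal.{u} → Ordinal.{u} := fun l =>
    if h : ∀ x ∈ l, x < δ.ord then e (l.attach.map fun x => ⟨x.1, h x.1 x.2⟩) else 0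
  have hc : ∀ l : List (Iio δ.ord), c (l.map (↑)) = e l := by
    intro l
    have h : ∀ x ∈ l.map (Subtype.val), x < δ.ord := by
      intro x hx
      obtain ⟨y, -, rfl⟩ := List.mem_map.1 hx
      exact y.2
    have h2 : ((l.map Subtype.val).attach.map fun x => (⟨x.1, h x.1 x.2⟩ : Iio δ.ord)) = l := by
      apply List.map_injective_iff.2 Subtype.val_injective
      simp
    simp only [c, dif_pos h, h2]
  refine ⟨c, fun l hl => ?_, fun l l' hl hl' h => ?_⟩
  · lift l to List (Iio δ.ord) using hl
    rw [hc]
    exact (e l).2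
  · lift l to List (Iio δ.ord) using hl
    lift l' to List (Iio δ.ord) using hl'
    rw [hc, hc] at h
    rw [e.injective (Subtype.ext h)]

variable {L : FirstOrder.Language.{0, 0}}

/-- If weak structural reflection failed at every `κ < ν`, there would be structures `B κ` in `C`
of size `κ`, for all large `κ < ν`, into which no smaller element of `C` embeds elementarily.
Subtlety of `ν`, applied to the elementary diagrams of the `B κ` coded as subsets of `κ`, makes one
of them an elementary substructure of another. -/
theorem IsSubtle.exists_WSR [Countable L.Symbols] {ν : Cardinal.{u}} (hν : IsSubtle ν)
    (sym : L.Symbols ↪ ZFSet.{u}) (C : ZFSet.{u}) (A : SetStructure.{u} L) (hA : A.code sym ∈ C)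
    (hAν : A.dom.card < ν) : ∃ κ < ν, WSR sym C κ := by
  by_contra! hno
  set κ₀ := max ℵ₀ (succ A.dom.card) with hκ₀
  have hκ₀ν : κ₀ < ν := max_lt hν.aleph0_lt (hν.isInaccessible.isSuccLimit.succ_lt hAν)
  have hB : ∀ κ : Cardinal.{u}, ∃ B : SetStructure.{u} L, κ₀ ≤ κ → κ < ν → B.code sym ∈ C ∧
      B.dom.card = κ ∧ ∀ A' : SetStructure.{u} L, A'.code sym ∈ C → A'.dom.card < κ →
        IsEmpty (A'.dom ↪ₑ[L] B.dom) := by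
    intro κ
    by_cases h1 : κ₀ ≤ κ ∧ κ < ν
    · have h2 := hno κ h1.2
      have h3 : ¬ SRMinus sym C κ := fun h => h2 ⟨(le_max_left _ _).trans h1.1, h, A, hA,
        (lt_succ _).trans_le ((le_max_right _ _).trans h1.1)⟩
      simp only [SRMinus, not_forall] at h3
      obtain ⟨B, hBC, hBκ, h4⟩ := h3
      refine ⟨B, fun _ _ => ⟨hBC, hBκ, fun A' hA' hlt => not_nonempty_iff.1 fun h => ?_⟩⟩
      exact h4 ⟨A', hA', hlt, h⟩
    · exact ⟨A, fun h h' => (h1 ⟨h, h'⟩).elim⟩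
  choose B hB using hB
  obtain ⟨c, hc, hcinj⟩ := exists_list_coding hν.1
  obtain ⟨e, he⟩ := Countable.exists_injective_nat (Σ n, L.Formula (Fin n))
  set D := closurePoints c κ₀.ord with hDdef
  have hD : IsClubIn D ν.ord := isClubIn_closurePoints hν.isInaccessible hc (ord_lt_ord.2 hκ₀ν)
  have hDom : ∀ γ ∈ D, γ < ν.ord → κ₀ ≤ γ.card ∧ γ.card < ν := fun γ hγ hγν =>
    ⟨by simpa using card_le_card hγ.1, lt_ord.1 hγν⟩
  -- the domain of `B γ` is identified with `γ`
  have hequiv : ∀ γ : Ordinal.{u}, γ ∈ D → γ < ν.ord → Nonempty ((B γ.card).dom ≃ Iio γ) := by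
    intro γ hγ hγν
    obtain ⟨h1, h2⟩ := hDom γ hγ hγν
    refine Cardinal.eq.1 ?_
    rw [ZFSet.cardinalMk_coe_sort, (hB _ h1 h2).2.1, Cardinal.mk_Iio_ordinal]
  -- the pair of a formula and a tuple of ordinals, coded by one ordinal
  let code : (n : ℕ) → L.Formula (Fin n) → (Fin n → Ordinal.{u}) → Ordinal.{u} := fun n φ v =>
    c ((e ⟨n, φ⟩ : Ordinal.{u}) :: List.ofFn v)
  have hlist : ∀ γ : Ordinal.{u}, ω ≤ γ → ∀ n (φ : L.Formula (Fin n)) (v : Fin n → Ordinal.{u}),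
      (∀ i, v i < γ) → ∀ x ∈ (e ⟨n, φ⟩ : Ordinal.{u}) :: List.ofFn v, x < γ := by
    intro γ hγ n φ v hv x hx
    rcases List.mem_cons.1 hx with rfl | hx
    · exact (natCast_lt_omega0 _).trans_le hγ
    · obtain ⟨i, rfl⟩ := List.mem_ofFn.1 hx
      exact hv i
  have hων : ω ≤ ν.ord := by simpa using ord_le_ord.2 hν.1
  have hcode : ∀ n (φ : L.Formula (Fin n)) v φ' v', (∀ i, v i < ν.ord) → (∀ i, v' i < ν.ord) →
      code n φ v = code n φ' v' → φ = φ' ∧ v = v' := by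
    intro n φ v φ' v' hv hv' h
    have h1 := hcinj _ _ (hlist _ hων _ _ _ hv) (hlist _ hων _ _ _ hv') h
    obtain ⟨h2, h3⟩ := List.cons_eq_cons.1 h1
    have h4 := he (Nat.cast_injective h2)
    exact ⟨by simpa using h4, List.ofFn_injective h3⟩
  -- `E γ` codes the elementary diagram of `B γ`, transferred to the domain `γ`
  let E : Ordinal.{u} → Set Ordinal.{u} := fun γ => {ξ | ∃ (h₁ : γ ∈ D) (h₂ : γ < ν.ord) (n : ℕ)
    (φ : L.Formula (Fin n)) (v : Fin n → Iio γ), ξ = code n φ (fun i => v i) ∧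
      φ.Realize ((hequiv γ h₁ h₂).some.symm ∘ v)}
  obtain ⟨β, hβ, γ, hγ, hlt, hγν, H⟩ := hν.exists_agree E hD
  have hβν := hlt.trans hγν
  let hb := (hequiv β hβ hβν).some
  let hg := (hequiv γ hγ hγν).some
  have hωβ : ω ≤ β := by
    have : (ℵ₀ : Cardinal.{u}).ord ≤ κ₀.ord := ord_le_ord.2 (le_max_left _ _)
    rw [ord_aleph0] at this
    exact this.trans hβ.1
  have hE : ∀ (α : Ordinal.{u}) (hα : α ∈ D) (hαν : α < ν.ord) (n : ℕ) (φ : L.Formula (Fin n))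
      (v : Fin n → Iio α), code n φ (fun i => v i) ∈ E α ↔
        φ.Realize ((hequiv α hα hαν).some.symm ∘ v) := by
    intro α hα hαν n φ v
    refine ⟨?_, fun h => ⟨hα, hαν, n, φ, v, rfl, h⟩⟩
    rintro ⟨_, _, m, ψ, w, heq, hw⟩
    have hvw := hcinj _ _ (hlist _ hων _ _ _ fun i => (v i).2.trans hαν)
      (hlist _ hων _ _ _ fun i => (w i).2.trans hαν) heq
    obtain rfl : n = m := by simpa using congrArg List.length hvw
    obtain ⟨rfl, h2⟩ := hcode n φ _ ψ _ (fun i => (v i).2.trans hαν)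
      (fun i => (w i).2.trans hαν) heq
    obtain rfl : v = w := funext fun i => Subtype.ext (congrFun h2 i)
    exact hw
  obtain ⟨h1, h2⟩ := hDom γ hγ hγν
  obtain ⟨h3, h4⟩ := hDom β hβ hβν
  have hcard : β.card < γ.card := by
    rw [← ord_lt_ord, ord_card_of_mem_closurePoints hβ, ord_card_of_mem_closurePoints hγ]
    exact hlt
  have hempty := (hB _ h1 h2).2.2 _ (hB _ h3 h4).1 (by rwa [(hB _ h3 h4).2.1])
  refine hempty.false ⟨fun x => hg.symm ⟨hb x, lt_trans (hb x).2 hlt⟩, fun n φ x => ?_⟩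
  have hx := H _ (hβ.2.2 _ (hlist β hωβ n φ (fun i => hb (x i)) fun i => (hb (x i)).2))
  have e1 := hE β hβ hβν n φ fun i => hb (x i)
  have e2 := hE γ hγ hγν n φ fun i => ⟨hb (x i), lt_trans (hb (x i)).2 hlt⟩
  have e3 := e2.symm.trans (hx.symm.trans e1)
  have e4 : (hequiv β hβ hβν).some.symm ∘ (fun i => hb (x i)) = x := funext fun i =>
    hb.symm_apply_apply (x i)
  rw [e4] at e3
  exact e3

theorem card_lt_of_rank_lt {ν : Cardinal.{u}} (hν : IsInaccessible ν) {x : ZFSet.{u}}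
    (hx : x.rank < ν.ord) : x.card < ν := by
  refine (ZFSet.card_mono x.subset_vonNeumann_self).trans_lt ?_
  rw [ZFSet.card_vonNeumann]
  simpa [hν.preBeth_ord] using preBeth_strictMono hx

theorem rank_dom_lt_rank_code (sym : L.Symbols ↪ ZFSet.{u}) (A : SetStructure.{u} L) :
    A.dom.rank < (A.code sym).rank := by
  simp [SetStructure.code, ZFSet.pair, ZFSet.rank_insert]

/-! ### Lists that disagree everywhere -/

/-- At an ordinal that is not a subtle cardinal, some list disagrees with itself along a closed
unbounded set. For an ordinal that is not a cardinal, the list of singletons coming from an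
injection into its cardinality will do. -/
theorem exists_disagree_on_club {o : Ordinal.{u}} (ho : ω ≤ o)
    (hns : ∀ ν : Cardinal.{u}, ν.ord = o → ¬ IsSubtle ν) :
    ∃ (E : Ordinal.{u} → Set Ordinal.{u}) (D : Set Ordinal.{u}), IsClubIn D o ∧
      ∀ β ∈ D, ∀ γ ∈ D, β < γ → γ < o → ∃ ξ < β, ¬ (ξ ∈ E β ↔ ξ ∈ E γ) := by
  by_cases hc : o.card.ord = o
  · have := exists_disagree_of_not_isSubtle (δ := o.card) (by simpa using ho) (hns _ hc)
    rwa [hc] at this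
  · have hlt : o.card.ord < o := (ord_card_le o).lt_of_ne hc
    obtain ⟨e⟩ : Nonempty (Iio o ≃ Iio o.card.ord) := Cardinal.eq.1 (by
      simp [Cardinal.mk_Iio_ordinal])
    refine ⟨fun γ => {ξ | ∃ h : γ < o, ξ = e ⟨γ, h⟩}, _, isClubIn_Ici hlt, ?_⟩
    intro β hβ γ hγ hβγ hγo
    have hβo := hβγ.trans hγo
    refine ⟨e ⟨β, hβo⟩, (e ⟨β, hβo⟩).2.trans_le hβ, fun h => ?_⟩
    obtain ⟨_, h1⟩ := h.1 ⟨hβo, rfl⟩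
    have h2 := congrArg Subtype.val (e.injective (Subtype.ext h1))
    exact hβγ.ne h2

/-- `Disagree F μ o` says that the countably many lists `F · n` of sets of ordinals jointly
disagree with themselves at all pairs of ordinals in the interval `(μ, o)`. -/
def Disagree (F : Ordinal.{u} → ℕ → Set Ordinal.{u}) (μ o : Ordinal.{u}) : Prop :=
  ∀ β γ, μ < β → β < γ → γ < o → ∃ n, ∃ ξ < β, ¬ (ξ ∈ F β n ↔ ξ ∈ F γ n)

/-- If there are no subtle cardinals in `(μ, o]`, then the failures of subtlety can be glued into
countably many lists that disagree with themselves at all pairs of ordinals in `(μ, o)`, not just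
along a closed unbounded set. By induction on `o`: for `D` closed unbounded in `o`, an ordinal
outside `D` uses the lists of the next element of `D`, and records the last element of `D` below. -/
theorem exists_disagree (μ : Ordinal.{u}) (hμ : ω ≤ μ) (o : Ordinal.{u})
    (hns : ∀ ν : Cardinal.{u}, μ < ν.ord → ν.ord ≤ o → ¬ IsSubtle ν) :
    ∃ F : Ordinal.{u} → ℕ → Set Ordinal.{u}, Disagree F μ o := by
  induction o using WellFoundedLT.induction with
  | _ o ih =>
  rcases le_or_gt o μ with hoμ | hμo
  · exact ⟨fun _ _ => ∅, fun β γ h1 h2 h3 => ((h1.trans h2).trans h3).not_ge hoμ |>.elim⟩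
  obtain ⟨E, D, hD, hdis⟩ := exists_disagree_on_club (hμ.trans hμo.le)
    fun ν hν => hns ν (hν ▸ hμo) hν.le
  choose! F hF using fun o' (h : o' < o) => ih o' h fun ν h1 h2 => hns ν h1 (h2.trans h.le)
  -- `θ β` is the least element of `D` that is at least `β`
  have hnext : ∀ β, ∃ θ, β < o → θ ∈ D ∧ β ≤ θ ∧ θ < o ∧ ∀ d ∈ D, β ≤ d → θ ≤ d := by
    intro β
    by_cases hβ : β < o
    · obtain ⟨b, hb, hβb, hbo⟩ := hD.exists_ge β hβ
      have h := csInf_mem (s := {d | d ∈ D ∧ β ≤ d}) ⟨b, (⟨hb, hβb⟩ : b ∈ D ∧ β ≤ b)⟩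
      exact ⟨_, fun _ => ⟨h.1, h.2, lt_of_le_of_lt (csInf_le' ⟨hb, hβb⟩) hbo,
        fun d hd hβd => csInf_le' ⟨hd, hβd⟩⟩⟩
    · exact ⟨0, fun h => (hβ h).elim⟩
  choose θ hθ using hnext
  -- the first two sets encode truth values as constant sets; the third has the last element of
  -- `D` below `β` as its only element below `β`, if there is one
  let G : Ordinal.{u} → ℕ → Set Ordinal.{u} := fun β n => match n with
    | 0 => {_ξ | β ∈ D}
    | 1 => {_ξ | ∃ d ∈ D, d < β}
    | 2 => {ξ | ξ ∈ D ∧ ∀ d ∈ D, d < β → d ≤ ξ}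
    | 3 => E β
    | n + 4 => F (θ β) β n
  refine ⟨G, fun β γ hβ hβγ hγ => ?_⟩
  by_contra! hag
  have hpos : 0 < β := hβ.bot_lt
  have hβo := hβγ.trans hγ
  have h0 : β ∈ D ↔ γ ∈ D := hag 0 0 hpos
  have h1 : (∃ d ∈ D, d < β) ↔ ∃ d ∈ D, d < γ := hag 1 0 hpos
  by_cases hβD : β ∈ D
  · obtain ⟨ξ, hξ, h⟩ := hdis β hβD γ (h0.1 hβD) hβγ hγ
    exact h (hag 3 ξ hξ)
  -- no element of `D` lies between `β` and `γ`
  have hno : ∀ d ∈ D, d < γ → d < β := by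
    intro d hd hdγ
    obtain ⟨y, hy, hyβ⟩ := h1.2 ⟨d, hd, hdγ⟩
    -- by closure, `D` has a largest element below `β`, as `β` is not in `D`
    obtain ⟨a, ha, haβ⟩ : ∃ a, (∀ d ∈ D, d < β → d ≤ a) ∧ a ∈ D ∧ a < β := by
      by_contra! hcon
      refine hβD (hD.mem_of_approx β hβo ⟨y, hy, hyβ.le⟩ fun a ha => ?_)
      by_contra! hcon'
      have hle : ∀ d ∈ D, d < β → d ≤ a := fun d hd hdβ =>
        not_lt.1 fun h => (hcon' d hd h).not_gt hdβ
      have hsup : IsLUB {d | d ∈ D ∧ d < β} (sSup {d | d ∈ D ∧ d < β}) :=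
        isLUB_csSup ⟨y, hy, hyβ⟩ ⟨β, fun d hd => hd.2.le⟩
      have hsa : sSup {d | d ∈ D ∧ d < β} ≤ a := hsup.2 fun d hd => hle d hd.1 hd.2
      refine (hcon _ (fun d hd hdβ => hsup.1 ⟨hd, hdβ⟩) ?_).not_gt (hsa.trans_lt ha)
      refine hD.mem_of_approx _ ((hsa.trans_lt ha).trans hβo) ⟨y, hy, hsup.1 ⟨hy, hyβ⟩⟩
        fun b hb => ?_
      obtain ⟨z, hz, hbz⟩ := (lt_isLUB_iff hsup).1 hb
      exact ⟨z, hz.1, hbz, hsup.1 hz⟩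
    exact (((hag 2 a haβ.2).1 ⟨haβ.1, ha⟩).2 d hd hdγ).trans_lt haβ.2
  have hγD : γ ∉ D := fun h => hβD (h0.2 h)
  obtain ⟨hθ1, hθ2, hθ3, hθ4⟩ := hθ β hβo
  obtain ⟨hη1, hη2, hη3, hη4⟩ := hθ γ hγ
  have hγθ : γ ≤ θ β := not_lt.1 fun h => (hno _ hθ1 h).not_ge hθ2
  have heq : θ β = θ γ := (hθ4 _ hη1 (hβγ.le.trans hη2)).antisymm (hη4 _ hθ1 hγθ)
  have hγθ' : γ < θ β := hγθ.lt_of_ne fun h => hγD (h ▸ hθ1)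
  obtain ⟨n, ξ, hξ, h⟩ := hF _ hθ3 β γ hβ hβγ hγθ'
  have h5 : ξ ∈ F (θ β) β n ↔ ξ ∈ F (θ γ) γ n := hag (n + 4) ξ hξ
  rw [← heq] at h5
  exact h h5

/-! ### Rigid functions on a successor cardinal -/

/-- `f` is a sequence of ordinals below `η` that is cofinal in `η`. It need not be increasing. -/
def IsLadder (f : ℕ → Ordinal.{u}) (η : Ordinal.{u}) : Prop :=
  (∀ n, f n < η) ∧ ∀ ζ < η, ∃ n, ζ ≤ f n

/-- Every function from `χ` to `χ` has a closure point of countable cofinality in `S`. For a regular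
uncountable cardinal `χ` this says that the points of countable cofinality in `S` form a stationary
set. -/
def MeetsClosurePoints (S : Set Ordinal.{u}) (χ : Ordinal.{u}) : Prop :=
  ∀ g : Ordinal.{u} → Ordinal.{u}, (∀ ξ < χ, g ξ < χ) →
    ∃ η ∈ S, η < χ ∧ (∃ f, IsLadder f η) ∧ ∀ ξ < η, g ξ < η

/-- If `μ` many sets cover the points of countable cofinality in a final segment of `μ⁺`, then one of
them is stationary: closure points can be found for `μ` many functions at once. -/
theorem exists_meetsClosurePoints {μ : Cardinal.{u}} (hμ : ℵ₀ ≤ μ) {α : Ordinal.{u}}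
    (hα : α < (succ μ).ord) (S : Iio μ.ord → Set Ordinal.{u})
    (hS : ∀ η < (succ μ).ord, (∃ f, IsLadder f η) → α < η → ∃ i, η ∈ S i) :
    ∃ i, MeetsClosurePoints (S i) (succ μ).ord := by
  by_contra! hno
  simp only [MeetsClosurePoints, not_forall] at hno
  choose g hg hbad using hno
  have hreg : (succ μ).IsRegular := isRegular_succ hμ
  have hcof : (succ μ).ord.cof = succ μ := hreg.cof_ord
  let h : Ordinal.{u} → Ordinal.{u} := fun γ =>
    max (succ γ) (⨆ p : Iio μ.ord × Iio γ, g p.1 p.2 + 1)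
  have hh : ∀ γ < (succ μ).ord, h γ < (succ μ).ord := by
    intro γ hγ
    refine max_lt ((isSuccLimit_ord hreg.1).succ_lt hγ) (lift_iSup_add_one_lt_of_lt_cof ?_
      fun p => hg _ _ (lt_trans p.2.2 hγ))
    rw [← lift_cof, hcof]
    refine (Cardinal.lift_id'.{u, u + 1} _).trans_lt ?_
    rw [mk_prod, Cardinal.mk_Iio_ordinal, Cardinal.mk_Iio_ordinal, Cardinal.lift_id,
      Cardinal.lift_id, ← Cardinal.lift_mul, Cardinal.lift_lt, card_ord, lt_succ_iff]
    exact mul_le_of_le hμ le_rfl (lt_succ_iff.1 (lt_ord.1 hγ))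
  have hcl : ∀ γ i, ∀ ξ < γ, g i ξ < h γ := fun γ i ξ hξ =>
    (lt_iSup_add_one (fun p : Iio μ.ord × Iio γ => g p.1 p.2) (i, ⟨ξ, hξ⟩)).trans_le
      (le_max_right _ _)
  have hmono : StrictMono fun n => h^[n] (succ α) := strictMono_nat_of_lt_succ fun n => by
    rw [Function.iterate_succ_apply']
    exact (lt_succ _).trans_le (le_max_left _ _)
  have hlt : ∀ n, h^[n] (succ α) < nfp h (succ α) := fun n =>
    (hmono (Nat.lt_succ_self n)).trans_le (iterate_le_nfp _ _ _)
  have hη : nfp h (succ α) < (succ μ).ord :=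
    nfp_lt_ord (by rw [hcof]; exact hμ.trans_lt (lt_succ μ)) hh
      ((isSuccLimit_ord hreg.1).succ_lt hα)
  have hlad : IsLadder (fun n => h^[n] (succ α)) (nfp h (succ α)) :=
    ⟨hlt, fun ζ hζ => (lt_nfp_iff.1 hζ).imp fun _ h => h.le⟩
  obtain ⟨i, hi⟩ := hS _ hη ⟨_, hlad⟩ ((lt_succ α).trans (hlt 0))
  refine hbad i ⟨_, hi, hη, ⟨_, hlad⟩, fun ξ hξ => ?_⟩
  obtain ⟨n, hn⟩ := lt_nfp_iff.1 hξ
  have h1 := hcl _ i ξ hn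
  rw [← Function.iterate_succ_apply' h] at h1
  exact h1.trans (hlt _)

/-- The points of countable cofinality below a successor cardinal can be split into as many
stationary sets as there are ordinals below it. The proof uses an Ulam matrix. -/
theorem exists_stationary_partition {μ : Cardinal.{u}} (hμ : ℵ₀ ≤ μ) :
    ∃ s : Ordinal.{u} → Ordinal.{u}, (∀ ξ, s ξ < (succ μ).ord) ∧
      ∀ ζ < (succ μ).ord, MeetsClosurePoints {η | s η = ζ} (succ μ).ord := by
  set χ := (succ μ).ord with hχ
  have hχ0 : 0 < χ := (isRegular_succ hμ).ord_pos
  have hinj : ∀ ξ : Ordinal.{u}, ∃ e : Ordinal.{u} → Iio μ.ord, ξ < χ → InjOn e (Iio ξ) := by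
    intro ξ
    have hne : Nonempty (Iio μ.ord) := ⟨⟨0, by
      rw [mem_Iio, lt_ord, card_zero]; exact aleph0_pos.trans_le hμ⟩⟩
    by_cases hξ : ξ < χ
    · have hle : #(Iio ξ) ≤ #(Iio μ.ord) := by
        rw [Cardinal.mk_Iio_ordinal, Cardinal.mk_Iio_ordinal, Cardinal.lift_le, card_ord]
        exact lt_succ_iff.1 (lt_ord.1 hξ)
      obtain ⟨e⟩ := hle
      classical
      refine ⟨fun a => if h : a < ξ then e ⟨a, h⟩ else hne.some, fun _ a ha b hb hab => ?_⟩
      have ha : a < ξ := ha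
      have hb : b < ξ := hb
      exact congrArg Subtype.val (e.injective (by simpa only [dif_pos ha, dif_pos hb] using hab))
    · exact ⟨fun _ => hne.some, fun h => (hξ h).elim⟩
  choose e he using hinj
  have hα : ∀ α : Iio χ, ∃ i, MeetsClosurePoints {ξ | α.1 < ξ ∧ e ξ α = i} χ := fun α =>
    exists_meetsClosurePoints hμ α.2 _ fun η _ _ hαη => ⟨e η α, hαη, rfl⟩
  choose i hi using hα
  have hcard : #(Iio χ) = Cardinal.lift.{u + 1} (succ μ) := by
    rw [Cardinal.mk_Iio_ordinal, hχ, card_ord]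
  obtain ⟨k, hk⟩ := infinite_pigeonhole_card i (Cardinal.lift.{u + 1} (succ μ)) hcard.ge
    (Cardinal.aleph0_le_lift.2 (hμ.trans (le_succ μ))) (by
      rw [Cardinal.mk_Iio_ordinal, card_ord, ← lift_ord, ← lift_cof,
        (isRegular_succ hμ).cof_ord, Cardinal.lift_lt]
      exact lt_succ μ)
  rw [← hcard] at hk
  -- the ordinals whose stationary set lies in row `k` are as many as the ordinals below `χ`
  obtain ⟨p⟩ := hk
  classical
  let s : Ordinal.{u} → Ordinal.{u} := fun ξ =>
    if h : ∃ ζ : Iio χ, (p ζ).1.1 < ξ ∧ e ξ (p ζ).1 = k ∧ ξ < χ then h.choose.1 else 0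
  refine ⟨s, fun ξ => ?_, fun ζ hζ g hg => ?_⟩
  · by_cases h : ∃ ζ : Iio χ, (p ζ).1.1 < ξ ∧ e ξ (p ζ).1 = k ∧ ξ < χ
    · simp only [s, dif_pos h]
      exact h.choose.2
    · simp only [s, dif_neg h]
      exact hχ0
  · obtain ⟨η, ⟨h1, h2⟩, hηχ, hlad, hcl⟩ := hi (p ⟨ζ, hζ⟩).1 g hg
    refine ⟨η, ?_, hηχ, hlad, hcl⟩
    have hpk : i (p ⟨ζ, hζ⟩).1 = k := (p ⟨ζ, hζ⟩).2
    rw [hpk] at h2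
    have h : ∃ ζ : Iio χ, (p ζ).1.1 < η ∧ e η (p ζ).1 = k ∧ η < χ := ⟨⟨ζ, hζ⟩, h1, h2, hηχ⟩
    obtain ⟨h3, h4, -⟩ := h.choose_spec
    have h5 := he η hηχ h3 h1 (h4.trans h2.symm)
    have h6 := p.injective (Subtype.ext (Subtype.ext h5))
    change s η = ζ
    simp only [s, dif_pos h, h6]

theorem le_apply_of_strictMonoOn {j : Ordinal.{u} → Ordinal.{u}} {χ : Ordinal.{u}}
    (hj : StrictMonoOn j (Iio χ)) {η : Ordinal.{u}} (hη : η < χ) : η ≤ j η := by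
  induction η using WellFoundedLT.induction with
  | _ η ih =>
  by_contra! h
  exact (ih _ h (h.trans hη)).not_gt (hj (h.trans hη) hη h)

/-- A successor cardinal carries countably many functions such that no strictly increasing
self-map other than the identity commutes with them: ladders at the points of countable
cofinality, which make `j` fix each closure point of `j` of countable cofinality, and a partition
of these points into stationary sets, each of which then contains a fixed point. -/
theorem exists_rigid_functions {μ : Cardinal.{u}} (hμ : ℵ₀ ≤ μ) :
    ∃ f : ℕ → Ordinal.{u} → Ordinal.{u}, (∀ n, ∀ ξ < (succ μ).ord, f n ξ < (succ μ).ord) ∧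
      ∀ j : Ordinal.{u} → Ordinal.{u}, (∀ ξ < (succ μ).ord, j ξ < (succ μ).ord) →
        StrictMonoOn j (Iio (succ μ).ord) →
        (∀ n, ∀ ξ < (succ μ).ord, j (f n ξ) = f n (j ξ)) → ∀ ξ < (succ μ).ord, j ξ = ξ := by
  obtain ⟨s, hs, hpart⟩ := exists_stationary_partition hμ
  have hlad : ∀ ξ : Ordinal.{u}, ∃ c : ℕ → Ordinal.{u}, ((∃ f, IsLadder f ξ) → IsLadder c ξ) ∧
      (∀ n, c n ≤ ξ) ∧ ∀ ζ < ξ, ∃ n, ζ ≤ c n := by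
    intro ξ
    by_cases h : ∃ f, IsLadder f ξ
    · obtain ⟨f, hf⟩ := h
      exact ⟨f, fun _ => hf, fun n => (hf.1 n).le, hf.2⟩
    · exact ⟨fun _ => ξ, fun h' => (h h').elim, fun _ => le_rfl, fun ζ hζ => ⟨0, hζ.le⟩⟩
  -- elsewhere `c ξ` is constantly `ξ`, which keeps it unbounded in `ξ` at all points
  choose c hc1 hc2 hc3 using hlad
  refine ⟨fun n ξ => Nat.casesOn n (s ξ) (c ξ), ?_, ?_⟩
  · rintro (_ | n) ξ hξ
    exacts [hs ξ, (hc2 ξ n).trans_lt hξ]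
  · intro j hj hmono hcomm ζ hζ
    obtain ⟨η, hη, hηχ, hl, hcl⟩ := hpart ζ hζ j hj
    -- a ladder at `j η` is unbounded in `η`, but by commutation it is the image of one at `η`
    have hfix : j η = η := by
      refine (le_apply_of_strictMonoOn hmono hηχ).antisymm' (not_lt.1 fun hlt => ?_)
      obtain ⟨n, hn⟩ := hc3 _ _ hlt
      have h1 : j (c η n) = c (j η) n := hcomm (n + 1) η hηχ
      rw [← h1] at hn
      exact (hcl _ ((hc1 η hl).1 n)).not_ge hn
    have h2 : j (s η) = s (j η) := hcomm 0 η hηχ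
    have h3 : s η = ζ := hη
    rwa [hfix, h3] at h2

/-! ### Non-reflecting sets of structures -/

theorem rank_pair_lt {o : Ordinal.{u}} (ho : IsSuccLimit o) {x y : ZFSet.{u}} (hx : x.rank < o)
    (hy : y.rank < o) : (ZFSet.pair x y).rank < o := by
  simp only [ZFSet.pair, ZFSet.rank_insert, ZFSet.rank_singleton]
  simp only [max_lt_iff]
  exact ⟨ho.succ_lt (ho.succ_lt hx), ho.succ_lt (max_lt (ho.succ_lt hx) (ho.succ_lt hy))⟩

theorem rank_tuple_lt {o : Ordinal.{u}} (ho : IsSuccLimit o) :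
    ∀ {n : ℕ} (v : Fin n → ZFSet.{u}), (∀ i, (v i).rank < o) → (tuple v).rank < o
  | 0, _, _ => by simpa [tuple] using ho.bot_lt
  | _ + 1, v, h => rank_pair_lt ho (h 0) (rank_tuple_lt ho _ fun i => h i.succ)

theorem rank_range_le {α : Type*} [Small.{u} α] {f : α → ZFSet.{u}} {o : Ordinal.{u}}
    (h : ∀ i, (f i).rank < o) : (ZFSet.range f).rank ≤ o := by
  rw [ZFSet.rank_le_iff]
  intro y hy
  obtain ⟨i, rfl⟩ := ZFSet.mem_range.1 hy
  exact h i

theorem rank_interp_le (A : SetStructure.{u} L) (s : L.Symbols) :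
    (A.interp s).rank ≤ A.dom.rank + ω := by
  have ho : IsSuccLimit (A.dom.rank + ω) := isSuccLimit_add _ isSuccLimit_omega0
  have h : ∀ x : A.dom, (x : ZFSet.{u}).rank < A.dom.rank + ω := fun x =>
    (ZFSet.rank_lt_of_mem x.2).trans (lt_add_of_pos_right _ omega0_pos)
  rcases s with ⟨n, f⟩ | ⟨n, R⟩
  · exact rank_range_le fun v => rank_pair_lt ho (rank_tuple_lt ho _ fun i => h _) (h _)
  · exact rank_range_le fun v => rank_tuple_lt ho _ fun i => h _

/-- The code of a structure lies only slightly higher in the cumulative hierarchy than its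
domain, as long as the symbols are hereditarily finite. -/
theorem rank_code_lt [Countable L.Symbols] {δ : Cardinal.{u}} (hδ : ℵ₀ < δ)
    {sym : L.Symbols ↪ ZFSet.{u}}
    (hsym : ∀ s, (sym s).rank < ω) (A : SetStructure.{u} L) (hA : A.dom.rank < δ.ord) :
    (A.code sym).rank < δ.ord := by
  have hadd : ∀ o < δ.ord, o + ω < δ.ord := fun o ho =>
    isPrincipal_add_ord hδ.le ho (by rw [lt_ord, card_omega0]; exact hδ)
  have ho : IsSuccLimit (A.dom.rank + ω + ω) := isSuccLimit_add _ isSuccLimit_omega0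
  have hlt : A.dom.rank + ω < A.dom.rank + ω + ω := lt_add_of_pos_right _ omega0_pos
  have hlt' := hadd _ (hadd _ hA)
  refine rank_pair_lt (isSuccLimit_ord hδ.le) hA (lt_of_le_of_lt (rank_range_le fun s => ?_) hlt')
  exact rank_pair_lt ho ((hsym s).trans_le le_add_self) ((rank_interp_le A s).trans_lt hlt)

theorem exists_setStructure {X : Type*} [Small.{u} X] [Nonempty X] [L.Structure X]
    (f : X → ZFSet.{u}) (hf : Function.Injective f) :
    ∃ A : SetStructure.{u} L, A.dom = ZFSet.range f ∧ Nonempty (X ≃[L] A.dom) := by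
  let e : X ≃ (ZFSet.range f : ZFSet.{u}) :=
    Equiv.ofBijective (fun x => ⟨f x, ZFSet.mem_range_self x⟩)
      ⟨fun x y h => hf (congrArg Subtype.val h), fun ⟨y, hy⟩ => by
        obtain ⟨x, rfl⟩ := ZFSet.mem_range.1 hy
        exact ⟨x, rfl⟩⟩
  exact ⟨⟨ZFSet.range f, ZFSet.nonempty_of_mem (ZFSet.mem_range_self (Classical.arbitrary X)),
    e.inducedStructure⟩, rfl, ⟨e.inducedStructureEquiv⟩⟩

/-- Structures on the cardinals in `[χ, δ)` with no elementary embeddings from smaller to larger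
ones refute structural reflection below `δ`: take all their copies in `V_δ`. For `κ ≤ χ` there
is no structure of size less than `κ`, and for `κ > χ` the copies of the structure on `κ` do not
reflect. -/
theorem exists_not_WSR {δ χ : Cardinal.{u}} (hδ : ℵ₀ < δ) (hχ0 : χ ≠ 0) (hχδ : χ < δ)
    [Countable L.Symbols] [M : ∀ κ : Cardinal.{u}, L.Structure (Iio κ.ord)]
    (hM : ∀ β γ : Cardinal.{u}, χ ≤ β → β < γ → γ < δ → IsEmpty (Iio β.ord ↪ₑ[L] Iio γ.ord)) :
    ∃ (sym : L.Symbols ↪ ZFSet.{u}) (C : ZFSet.{u}), IsSetOfStructures sym C ∧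
      C ∈ ZFSet.vonNeumann (δ.ord + 1) ∧ C ∉ ZFSet.vonNeumann δ.ord ∧
        ∀ κ < δ, ¬ WSR sym C κ := by
  obtain ⟨e, he⟩ := Countable.exists_injective_nat L.Symbols
  let sym : L.Symbols ↪ ZFSet.{u} :=
    ⟨fun s => toZFSet (e s), fun s t h => he (Nat.cast_injective (toZFSet_injective h))⟩
  have hsym : ∀ s, (sym s).rank < ω := fun s => by
    change (toZFSet (e s)).rank < ω
    rw [rank_toZFSet]
    exact natCast_lt_omega0 _
  let P : SetStructure.{u} L → Prop := fun A =>
    ∃ κ : Cardinal.{u}, χ ≤ κ ∧ κ < δ ∧ Nonempty (Iio κ.ord ≃[L] A.dom)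
  let C : ZFSet.{u} := ZFSet.sep (fun x => ∃ A : SetStructure.{u} L, A.code sym = x ∧ P A)
    (ZFSet.vonNeumann δ.ord)
  have hC : ∀ A : SetStructure.{u} L, A.code sym ∈ C ↔ (A.code sym).rank < δ.ord ∧ P A := by
    intro A
    rw [ZFSet.mem_sep, ZFSet.mem_vonNeumann]
    refine and_congr_right fun _ => ⟨?_, fun h => ⟨A, rfl, h⟩⟩
    rintro ⟨A', h, hA'⟩
    rwa [← SetStructure.code_injective sym h]
  have hcard : ∀ (A : SetStructure.{u} L) (κ : Cardinal.{u}), Nonempty (Iio κ.ord ≃[L] A.dom) →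
      A.dom.card = κ := by
    rintro A κ ⟨h⟩
    have := Cardinal.mk_congr h.toEquiv
    rw [Cardinal.mk_Iio_ordinal, card_ord, ZFSet.cardinalMk_coe_sort, Cardinal.lift_inj] at this
    exact this.symm
  -- copies of the structure on `κ` with domains of arbitrarily large rank below `δ`
  have hcopy : ∀ κ : Cardinal.{u}, χ ≤ κ → κ < δ → ∀ α < δ.ord, ∃ A : SetStructure.{u} L,
      A.code sym ∈ C ∧ Nonempty (Iio κ.ord ≃[L] A.dom) ∧ α ≤ A.dom.rank := by
    intro κ hχκ hκδ α hα
    have h0 : (0 : Ordinal.{u}) < κ.ord := by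
      rw [lt_ord, card_zero]
      exact (pos_iff_ne_zero.2 hχ0).trans_le hχκ
    have : Nonempty (Iio κ.ord) := ⟨⟨0, h0⟩⟩
    obtain ⟨A, hA, hiso⟩ := exists_setStructure (L := L) (X := Iio κ.ord)
      (fun ξ => toZFSet (α + ξ)) fun ξ ζ h =>
        Subtype.ext (add_left_cancel (toZFSet_injective h))
    have hr : A.dom.rank ≤ α + κ.ord := by
      rw [hA]
      refine rank_range_le fun ξ => ?_
      rw [rank_toZFSet]
      exact add_lt_add_right ξ.2 α
    have hαA : α ≤ A.dom.rank := by
      have h1 : toZFSet (α + (⟨0, h0⟩ : Iio κ.ord)) ∈ A.dom := by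
        rw [hA]
        exact ZFSet.mem_range_self (f := fun ξ : Iio κ.ord => toZFSet (α + ξ)) _
      have h2 := ZFSet.rank_lt_of_mem h1
      rw [rank_toZFSet] at h2
      exact le_self_add.trans h2.le
    refine ⟨A, (hC A).2 ⟨rank_code_lt hδ hsym A (hr.trans_lt ?_), κ, hχκ, hκδ, hiso⟩, hiso, hαA⟩
    exact isPrincipal_add_ord hδ.le hα (ord_lt_ord.2 hκδ)
  refine ⟨sym, C, fun x hx => ?_, ?_, fun h => ?_, ?_⟩
  · obtain ⟨A, hA, -⟩ := (ZFSet.mem_sep.1 hx).2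
    exact ⟨A, hA⟩
  · rw [ZFSet.vonNeumann_add_one, ZFSet.mem_powerset]
    exact ZFSet.sep_subset
  · rw [ZFSet.mem_vonNeumann] at h
    obtain ⟨A, hA, -, hr⟩ := hcopy χ le_rfl hχδ _ h
    exact ((ZFSet.rank_lt_of_mem hA).trans_le hr).not_gt (rank_dom_lt_rank_code sym A)
  · rintro κ hκδ ⟨-, hSR, A, hA, hAκ⟩
    obtain ⟨κ', hκ', -, hiso⟩ := ((hC A).1 hA).2
    have hχκ : χ < κ := hκ'.trans_lt (hcard A κ' hiso ▸ hAκ)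
    obtain ⟨B, hB, ⟨i⟩, -⟩ := hcopy κ hχκ.le hκδ 0
      (by rw [lt_ord, card_zero]; exact aleph0_pos.trans hδ)
    obtain ⟨A', hA', hlt, ⟨j⟩⟩ := hSR B hB (hcard B κ ⟨i⟩)
    obtain ⟨κ'', h1, -, ⟨i'⟩⟩ := ((hC A').1 hA').2
    rw [hcard A' κ'' ⟨i'⟩] at hlt
    exact (hM κ'' κ h1 hlt hκδ).false
      ((i.symm.toElementaryEmbedding.comp j).comp i'.toElementaryEmbedding)

/-- The relation symbols of the language of the non-reflecting structures. -/
inductive OrdinalRel : ℕ → Type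
  /-- the order -/
  | lt : OrdinalRel 2
  /-- the graphs of countably many functions -/
  | graph (n : ℕ) : OrdinalRel 2
  /-- membership in the `n`-th set attached to an ordinal of the domain -/
  | mem (n : ℕ) : OrdinalRel 2
  /-- membership in the `n`-th set attached to the domain itself -/
  | memTop (n : ℕ) : OrdinalRel 1

/-- The language with the relation symbols `OrdinalRel` and no function symbols. -/
def ordinalLanguage : FirstOrder.Language.{0, 0} := ⟨fun _ => Empty, OrdinalRel⟩

instance : Countable ordinalLanguage.Symbols := by
  have h1 : IsEmpty (Σ n, ordinalLanguage.Functions n) := ⟨fun x => Empty.elim x.2⟩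
  let f : (Σ n, OrdinalRel n) → ℕ × ℕ := fun x => match x with
    | ⟨_, .lt⟩ => (0, 0)
    | ⟨_, .graph n⟩ => (1, n)
    | ⟨_, .mem n⟩ => (2, n)
    | ⟨_, .memTop n⟩ => (3, n)
  have h2 : Countable (Σ n, ordinalLanguage.Relations n) := by
    refine Function.Injective.countable (f := f) ?_
    rintro ⟨_, _ | n | n | n⟩ ⟨_, _ | m | m | m⟩ h <;> simp_all [f]
  exact inferInstanceAs (Countable (_ ⊕ _))

/-- The structure on an ordinal `o` given by the restrictions to `χ` of the functions `f n`, the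
sets `F α n` for `α < o`, and the sets `F o n`. -/
@[reducible] def ordinalStructure (χ : Ordinal.{u}) (f : ℕ → Ordinal.{u} → Ordinal.{u})
    (F : Ordinal.{u} → ℕ → Set Ordinal.{u}) (o : Ordinal.{u}) :
    ordinalLanguage.Structure (Iio o) where
  funMap g := Empty.elim g
  RelMap R := match R with
    | .lt => fun v => v 0 < v 1
    | .graph n => fun v => (v 0 : Ordinal.{u}) < χ ∧ (v 1 : Ordinal.{u}) = f n (v 0)
    | .mem n => fun v => (v 1 : Ordinal.{u}) ∈ F (v 0) n
    | .memTop n => fun v => (v 0 : Ordinal.{u}) ∈ F o n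

/-- There are no embeddings of smaller structures of this kind into larger ones. A map `j` that moves some
ordinal `α`, but none below, fixes `μ⁺` pointwise by rigidity, so that `α > μ`; but then
`F α = F (j α) ∩ α`, which the choice of `F` excludes. Likewise the identity map would yield
`F β = F γ ∩ β`. -/
theorem isEmpty_elementaryEmbedding {μ : Cardinal.{u}} {δ : Ordinal.{u}}
    {f : ℕ → Ordinal.{u} → Ordinal.{u}} {F : Ordinal.{u} → ℕ → Set Ordinal.{u}}
    (hfχ : ∀ n, ∀ ξ < (succ μ).ord, f n ξ < (succ μ).ord)
    (hf : ∀ j : Ordinal.{u} → Ordinal.{u}, (∀ ξ < (succ μ).ord, j ξ < (succ μ).ord) →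
      StrictMonoOn j (Iio (succ μ).ord) →
      (∀ n, ∀ ξ < (succ μ).ord, j (f n ξ) = f n (j ξ)) → ∀ ξ < (succ μ).ord, j ξ = ξ)
    (hF : Disagree F μ.ord δ) {β γ : Ordinal.{u}} (hβ : (succ μ).ord ≤ β) (hβγ : β < γ)
    (hγ : γ < δ) :
    letI := ordinalStructure (succ μ).ord f F
    IsEmpty (Iio β ↪ₑ[ordinalLanguage] Iio γ) := by
  let _ := ordinalStructure (succ μ).ord f F
  refine ⟨fun i => ?_⟩
  have hμχ : μ.ord < (succ μ).ord := ord_lt_ord.2 (lt_succ μ)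
  classical
  let j : Ordinal.{u} → Ordinal.{u} := fun ξ => if h : ξ < β then i ⟨ξ, h⟩ else ξ
  have hj : ∀ (ξ : Ordinal.{u}) (h : ξ < β), j ξ = i ⟨ξ, h⟩ := fun ξ h => dif_pos h
  have hjγ : ∀ ξ < β, j ξ < γ := fun ξ h => by rw [hj ξ h]; exact (i ⟨ξ, h⟩).2
  have hlt : ∀ ξ < β, ∀ ζ < β, ξ < ζ → j ξ < j ζ := by
    intro ξ hξ ζ hζ h
    rw [hj ξ hξ, hj ζ hζ]
    exact (i.map_rel (OrdinalRel.lt : ordinalLanguage.Relations 2) ![⟨ξ, hξ⟩, ⟨ζ, hζ⟩]).2 h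
  have hgraph : ∀ n, ∀ ξ < (succ μ).ord, j ξ < (succ μ).ord ∧ j (f n ξ) = f n (j ξ) := by
    intro n ξ hξ
    have h1 := hξ.trans_le hβ
    have h2 := (hfχ n ξ hξ).trans_le hβ
    rw [hj ξ h1, hj _ h2]
    exact (i.map_rel (OrdinalRel.graph n : ordinalLanguage.Relations 2)
      ![⟨ξ, h1⟩, ⟨f n ξ, h2⟩]).2 ⟨hξ, rfl⟩
  have hmem : ∀ n, ∀ ξ < β, ∀ α < β, ξ ∈ F α n ↔ j ξ ∈ F (j α) n := by
    intro n ξ hξ α hα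
    rw [hj ξ hξ, hj α hα]
    exact (i.map_rel (OrdinalRel.mem n : ordinalLanguage.Relations 2) ![⟨α, hα⟩, ⟨ξ, hξ⟩]).symm
  have htop : ∀ n, ∀ ξ < β, ξ ∈ F β n ↔ j ξ ∈ F γ n := by
    intro n ξ hξ
    rw [hj ξ hξ]
    exact (i.map_rel (OrdinalRel.memTop n : ordinalLanguage.Relations 1) ![⟨ξ, hξ⟩]).symm
  have hmono : StrictMonoOn j (Iio β) := fun ξ hξ ζ hζ h => hlt ξ hξ ζ hζ h
  have hrig := hf j (fun ξ hξ => (hgraph 0 ξ hξ).1) (hmono.mono (Iio_subset_Iio hβ))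
    fun n ξ hξ => (hgraph n ξ hξ).2
  have hid : ∀ α < β, j α = α := by
    intro α
    induction α using WellFoundedLT.induction with
    | _ α ih =>
    intro hα
    rcases lt_or_ge α (succ μ).ord with hαχ | hαχ
    · exact hrig α hαχ
    · by_contra hne
      obtain ⟨n, ξ, hξ, h⟩ := hF α (j α) (hμχ.trans_le hαχ)
        ((le_apply_of_strictMonoOn hmono hα).lt_of_ne' hne) ((hjγ α hα).trans hγ)
      have h1 := hmem n ξ (hξ.trans hα) α hα
      rw [ih ξ hξ (hξ.trans hα)] at h1
      exact h h1
  obtain ⟨n, ξ, hξ, h⟩ := hF β γ (hμχ.trans_le hβ) hβγ hγ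
  have h1 := htop n ξ hξ
  rw [hid ξ hξ] at h1
  exact h h1

theorem exists_not_WSR_of_not_subtle {δ : Cardinal.{u}} (hδ : ℵ₀ < δ) (h1 : ¬ IsSubtle δ)
    (h2 : ¬ IsLimitOfSubtle δ) :
    ∃ (L : FirstOrder.Language.{0, 0}) (_ : Countable L.Symbols) (sym : L.Symbols ↪ ZFSet.{u})
      (C : ZFSet.{u}), IsSetOfStructures sym C ∧ C ∈ ZFSet.vonNeumann (δ.ord + 1) ∧
        C ∉ ZFSet.vonNeumann δ.ord ∧ ∀ κ < δ, ¬ WSR sym C κ := by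
  have hδ0 : δ ≠ 0 := (aleph0_pos.trans hδ).ne'
  simp only [IsLimitOfSubtle, hδ0, ne_eq, not_false_eq_true, true_and, not_forall] at h2
  obtain ⟨μ₀, hμ₀, hno⟩ := h2
  let μ := max ℵ₀ μ₀
  have hμ : ℵ₀ ≤ μ := le_max_left _ _
  have hμδ : μ < δ := max_lt hδ hμ₀
  have hns : ∀ ν : Cardinal.{u}, μ.ord < ν.ord → ν.ord ≤ δ.ord → ¬ IsSubtle ν := by
    intro ν hν hνδ hsub
    rcases (ord_le_ord.1 hνδ).eq_or_lt with rfl | hlt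
    · exact h1 hsub
    · exact hno ⟨ν, (le_max_right _ _).trans_lt (ord_lt_ord.1 hν), hlt, hsub⟩
  rcases (succ_le_of_lt hμδ).eq_or_lt with heq | hlt
  · -- for `δ = μ⁺`, all structures of size `μ` in the empty language will do
    refine ⟨Language.empty, inferInstance, ?_⟩
    let _ : ∀ κ : Cardinal.{u}, Language.empty.Structure (Iio κ.ord) := fun _ =>
      ⟨fun g => Empty.elim g, fun r => Empty.elim r⟩
    refine exists_not_WSR hδ (aleph0_pos.trans_le hμ).ne' hμδ fun β γ hβ hβγ hγ => ?_
    rw [← heq, lt_succ_iff] at hγ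
    exact ((hβ.trans_lt hβγ).not_ge hγ).elim
  · obtain ⟨F, hF⟩ := exists_disagree μ.ord (by simpa using hμ) δ.ord hns
    obtain ⟨f, hfχ, hf⟩ := exists_rigid_functions hμ
    refine ⟨ordinalLanguage, inferInstance, ?_⟩
    let _ : ∀ κ : Cardinal.{u}, ordinalLanguage.Structure (Iio κ.ord) := fun κ =>
      ordinalStructure (succ μ).ord f F κ.ord
    exact exists_not_WSR hδ (succ_ne_zero μ) hlt fun β γ hβ hβγ hγ =>
      isEmpty_elementaryEmbedding hfχ hf hF (ord_le_ord.2 hβ) (ord_lt_ord.2 hβγ)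
        (ord_lt_ord.2 hγ)

end SetTheoreticReflection


theorem theorem1p14 (δ : Cardinal.{u}) (hδ : Cardinal.aleph0 < δ) :
    (SetTheoreticReflection.IsSubtle δ ∨ SetTheoreticReflection.IsLimitOfSubtle δ) ↔
      ∀ (L : FirstOrder.Language.{0, 0}) (_ : Countable L.Symbols)
        (sym : L.Symbols ↪ ZFSet.{u}) (C : ZFSet.{u}),
        SetTheoreticReflection.IsSetOfStructures sym C →
        C ∈ ZFSet.vonNeumann (δ.ord + 1) → C ∉ ZFSet.vonNeumann δ.ord →
        ∃ κ : Cardinal.{u}, κ < δ ∧ SetTheoreticReflection.WSR sym C κ := by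
  constructor
  · intro h L _ sym C hC hC1 hC2
    obtain ⟨x, hx⟩ : C.Nonempty := by
      refine (C.eq_empty_or_nonempty).resolve_left ?_
      rintro rfl
      refine hC2 (ZFSet.mem_vonNeumann.2 ?_)
      rw [ZFSet.rank_empty, Cardinal.lt_ord, Ordinal.card_zero]
      exact Cardinal.aleph0_pos.trans hδ
    obtain ⟨A, rfl⟩ := hC x hx
    have hrank : A.dom.rank < δ.ord := by
      rw [ZFSet.vonNeumann_add_one, ZFSet.mem_powerset] at hC1
      exact (SetTheoreticReflection.rank_dom_lt_rank_code sym A).trans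
        (ZFSet.mem_vonNeumann.1 (hC1 hx))
    rcases h with h | h
    · exact h.exists_WSR sym C A hx
        (SetTheoreticReflection.card_lt_of_rank_lt h.isInaccessible hrank)
    · obtain ⟨ν, hν, hνδ, hsub⟩ := h.2 _ (Cardinal.lt_ord.1 hrank)
      obtain ⟨κ, hκ, hWSR⟩ := hsub.exists_WSR sym C A hx
        (SetTheoreticReflection.card_lt_of_rank_lt hsub.isInaccessible (Cardinal.lt_ord.2 hν))
      exact ⟨κ, hκ.trans hνδ, hWSR⟩
  · intro h
    by_contra! hno
    obtain ⟨L, hL, sym, C, hC, hC1, hC2, hfail⟩ :=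
      SetTheoreticReflection.exists_not_WSR_of_not_subtle hδ hno.1 hno.2
    obtain ⟨κ, hκ, hWSR⟩ := h L hL sym C hC hC1 hC2
    exact hfail κ hκ hWSR
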